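/- The eccentric sequence of a finite connected graph is the nondecreasing sequence of the eccentricities of its vertices, and a tree eccentric sequence is the eccentric sequence of some tree with at least two vertices. Let $S$ be a tree eccentric sequence, let $b_1<b_2<\dots<b_l$ be the different values in $S$, let $m_i$ be the number of times that $b_i$ occurs in $S$, and put $r=b_1$; write $S=(r;m_2,\dots,m_l)$. Let $\mathbf{T}(r;m_2,\dots,m_l)$ be the tree obtained from a path $v_0,v_1,\dots,v_{r+l-1}$ by attaching $m_j-2$ pendent edges to the vertex $v_{l+1-j}$ for every $2\le j\le l$. Then $\mathbf{T}(r;m_2,\dots,m_l)$ has eccentric sequence $S$ and, among all trees $T$ whose eccentric sequence is $S$, it is (up to isomorphism) the unique minimiser of each of the following, where the sums are over all unordered pairs of distinct vertices, $d_T(u,v)$ is the distance of $u$ and $v$ in $T$, and $d$ is the diameter of $T$: - the Wiener index $W(T)=\sum_{\{u,v\}\subseteq V(T)} d_T(u,v)$; - the hyper-Wiener index $WW(T)=\sum_{\{u,v\}\subseteq V(T)}\binom{1+d_T(u,v)}{2}$; - the generalised Wiener index $W^{\lambda}(T)=\sum_{\{u,v\}\subseteq V(T)} d_T(u,v)^{\lambda}$,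 for every real $\lambda>0$; - the reciprocal complementary Wiener index $RCW(T)=\sum_{\{u,v\}\subseteq V(T)}\frac{1}{d+1-d_T(u,v)}$. -/

import Mathlib

universe u

/-- The eccentricity of a vertex as a natural number: the largest distance from `v` to a vertex of
`G`. (For a finite connected graph, `G.eccent v` is finite.) -/
noncomputable def ecc {V : Type u} (G : SimpleGraph V) (v : V) : ℕ :=
  (G.eccent v).toNat

/-- The eccentric sequence of a finite connected graph: the nondecreasing sequence of the
eccentricities of its vertices. -/
noncomputable def eccentricSequence {V : Type u} [Fintype V] (G : SimpleGraph V) : List ℕ :=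
  ((Finset.univ : Finset V).val.map (ecc G)).sort (· ≤ ·)

/-- `S` is a tree eccentric sequence if it is the eccentric sequence of some tree with at least two
vertices. -/
def IsTreeEccentricSequence (S : List ℕ) : Prop :=
  ∃ (n : ℕ) (T : SimpleGraph (Fin n)), 2 ≤ n ∧ T.IsTree ∧ eccentricSequence T = S

/-- The different values `b₁ < b₂ < ⋯ < b_l` that occur in the sequence `S`. -/
def distinctValues (S : List ℕ) : List ℕ :=
  S.toFinset.sort (· ≤ ·)

/-- The entry `r = b₁` in the notation `S = (r; m₂, …, m_l)`: the least value in `S`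
(`0` if `S` is empty). -/
def leastValue (S : List ℕ) : ℕ :=
  (distinctValues S).headD 0

/-- The entries `[m₂, …, m_l]` in the notation `S = (r; m₂, …, m_l)`: the multiplicities in `S` of
the values `b₂ < ⋯ < b_l`. -/
def laterMultiplicities (S : List ℕ) : List ℕ :=
  (distinctValues S).tail.map (fun b => S.count b)

/-- The vertices of the tree `𝐓(r; m₂, …, m_l)`, where `m = [m₂, …, m_l]`, so that
`l = m.length + 1` and `m_j = m.get i` for `i = j - 2`: the vertices `v₀, …, v_{r+l-1}` of a path,
and `m_j - 2` further vertices for each `2 ≤ j ≤ l`. -/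
abbrev CatVertex (r : ℕ) (m : List ℕ) : Type :=
  Fin (r + m.length + 1) ⊕ (Σ i : Fin m.length, Fin (m.get i - 2))

/-- The tree `𝐓(r; m₂, …, m_l)` (for `r > 0` and `m₂, …, m_l > 1`), where `m = [m₂, …, m_l]`:
consecutive vertices of the path `v₀, …, v_{r+l-1}` are adjacent, and the `m_j - 2` further vertices
that belong to `j` are adjacent to the path vertex `v_{l+1-j}` only. With `i = j - 2` and
`l = m.length + 1`, the index `l + 1 - j` is `m.length - i`. -/
def catTree (r : ℕ) (m : List ℕ) : SimpleGraph (CatVertex r m) :=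
  SimpleGraph.fromRel fun x y =>
    match x, y with
    | Sum.inl p, Sum.inl q => p.val + 1 = q.val
    | Sum.inl p, Sum.inr c => p.val = m.length - c.1.val
    | Sum.inr _, _ => False

/-- The Wiener-type index `W(G; g)`: the sum of `g (d(u, v))` over all unordered pairs `{u, v}` of
distinct vertices. -/
noncomputable def wienerType {V : Type u} [Fintype V] [DecidableEq V] (G : SimpleGraph V)
    (g : ℕ → ℝ) : ℝ :=
  ∑ e ∈ (Finset.univ : Finset (Sym2 V)).filter (fun e => ¬ e.IsDiag),
    Sym2.lift ⟨fun u v => g (G.dist u v), fun u v => congrArg g SimpleGraph.dist_comm⟩ e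

/-- The Wiener index. -/
noncomputable def wienerIndex {V : Type u} [Fintype V] [DecidableEq V] (G : SimpleGraph V) : ℝ :=
  wienerType G (fun x => (x : ℝ))

/-- The hyper-Wiener index. -/
noncomputable def hyperWienerIndex {V : Type u} [Fintype V] [DecidableEq V]
    (G : SimpleGraph V) : ℝ :=
  wienerType G (fun x => ((Nat.choose (1 + x) 2 : ℕ) : ℝ))

/-- The generalised Wiener index with exponent `a`. -/
noncomputable def generalisedWienerIndex {V : Type u} [Fintype V] [DecidableEq V]
    (G : SimpleGraph V) (a : ℝ) : ℝ :=
  wienerType G (fun x => (x : ℝ) ^ a)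

/-- The reciprocal complementary Wiener index. -/
noncomputable def reciprocalComplementaryWienerIndex {V : Type u} [Fintype V] [DecidableEq V]
    (G : SimpleGraph V) : ℝ :=
  wienerType G (fun x => 1 / ((G.diam : ℝ) + 1 - (x : ℝ)))

/-! Fix a diametral path `p 0, …, p D` of the tree. A vertex `w` leaves it at a gate of index `i w`,
at height `h w`, and diametrality forces `h w ≤ min (i w) (D - i w)`, so its eccentricity is `h w +
D - min (i w) (D - i w)` (`IsGate.ecc_eq`). Send each off-path vertex to a pendent vertex of the
caterpillar at index `foot = 1 + min (i w) (D - i w) - h w`. This preserves eccentricities, and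
counting eccentricity classes shows that it can be made a bijection onto the caterpillar
(`IsGate.exists_equiv_pendent`).

For increasing `g`, compare the sums of `g` of distances under this bijection. Pairs on the path
agree. Two off-path vertices get no farther apart unless one is an ancestor of the other on its
branch; then their distance grows by exactly 2. These losses are charged to the lower vertex `w`:
its proper ancestors off the path have different heights, so the total loss is at most a
telescoping-type sum of `g (a+3) - g (a+1)`. The distances from `w` to the path gain at least that
much, and strictly more if `h w ≥ 2` (`IsGate.sum_ancestorLoss_lt_pathGain`).

In the equality case all heights are at most 1 and the distances between off-path vertices are those
of the caterpillar. Then all gates lie in one half of the path, and the tree is the caterpillar,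
read from one end or the other. -/

/-! ### Medians, geodesics and gates in trees. -/

section TreeGeometry

open SimpleGraph

variable {V : Type u} {G : SimpleGraph V}

/-- In a tree, two geodesics that meet only in their common end point `b` form a geodesic. -/
theorem SimpleGraph.IsTree.dist_eq_add_of_forall (hG : G.IsTree) (a b c : V)
    (h : ∀ z, G.dist a z + G.dist z b = G.dist a b → G.dist b z + G.dist z c = G.dist b c → z = b) :
    G.dist a c = G.dist a b + G.dist b c := by
  classical
  obtain ⟨p, hp, hpl⟩ := hG.1.exists_path_of_dist a b
  obtain ⟨q, hq, hql⟩ := hG.1.exists_path_of_dist b c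
  have hpath : (p.append q).IsPath := by
    rw [Walk.isPath_def, Walk.support_append, List.nodup_append]
    refine ⟨hp.support_nodup, hq.support_nodup.tail, ?_⟩
    rintro x hx y hy rfl
    have h1 : G.dist a x + G.dist x b = G.dist a b := by
      have := congrArg Walk.length (p.take_spec hx)
      rw [Walk.length_append] at this
      have h2 := dist_le (p.takeUntil x hx)
      have h3 := dist_le (p.dropUntil x hx)
      have h4 := hG.1.dist_triangle (u := a) (v := x) (w := b)
      omega
    have hy' : x ∈ q.support := List.mem_of_mem_tail hy
    have h2 : G.dist b x + G.dist x c = G.dist b c := by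
      have := congrArg Walk.length (q.take_spec hy')
      rw [Walk.length_append] at this
      have h2 := dist_le (q.takeUntil x hy')
      have h3 := dist_le (q.dropUntil x hy')
      have h4 := hG.1.dist_triangle (u := b) (v := x) (w := c)
      omega
    have hxb := h x h1 h2
    subst hxb
    have := hq.support_nodup
    rw [← Walk.cons_tail_support, List.nodup_cons] at this
    exact this.1 hy
  obtain ⟨s, hs, hsl⟩ := hG.1.exists_path_of_dist a c
  have := (hG.existsUnique_path a c).unique hs hpath
  rw [← hsl, this, Walk.length_append, hpl, hql]

/-- Three vertices of a tree have a median. -/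
theorem SimpleGraph.IsTree.exists_median [Finite V] (hG : G.IsTree) (a b c : V) :
    ∃ z, G.dist a b = G.dist a z + G.dist z b ∧ G.dist b c = G.dist b z + G.dist z c ∧
      G.dist a c = G.dist a z + G.dist z c := by
  classical
  have := Fintype.ofFinite V
  -- The median is where the geodesics from `b` to `a` and to `c` part: their common point farthest
  -- from `b`.
  obtain ⟨z, hz, hmax⟩ := Finset.exists_max_image
    (Finset.univ.filter fun z => G.dist a b = G.dist a z + G.dist z b ∧
      G.dist b c = G.dist b z + G.dist z c) (fun z => G.dist b z) ⟨b, by simp⟩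
  simp only [Finset.mem_filter, Finset.mem_univ, true_and] at hz hmax
  refine ⟨z, hz.1, hz.2, hG.dist_eq_add_of_forall a z c fun y h1 h2 => ?_⟩
  have t1 := hG.1.dist_triangle (u := y) (v := z) (w := b)
  have t2 := hG.1.dist_triangle (u := a) (v := y) (w := b)
  have t3 := hG.1.dist_triangle (u := b) (v := z) (w := y)
  have t4 := hG.1.dist_triangle (u := b) (v := y) (w := c)
  have c1 := G.dist_comm (u := y) (v := z)
  have c2 := G.dist_comm (u := b) (v := z)
  have c3 := G.dist_comm (u := b) (v := y)
  have := hmax y ⟨by omega, by omega⟩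
  have : G.dist y z = 0 := by omega
  exact hG.1.dist_eq_zero_iff.1 this

/-- The points of a geodesic of a tree are determined by their distance to its start. -/
theorem SimpleGraph.IsTree.eq_of_between (hG : G.IsTree) {a b x y : V}
    (hx : G.dist a x + G.dist x b = G.dist a b) (hy : G.dist a y + G.dist y b = G.dist a b)
    (hxy : G.dist a x = G.dist a y) : x = y := by
  have key : ∀ x, G.dist a x + G.dist x b = G.dist a b →
      ∀ w : G.Walk a b, w.IsPath → w.getVert (G.dist a x) = x := by
    intro x hx w hw
    obtain ⟨p, hp, hpl⟩ := hG.1.exists_path_of_dist a x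
    obtain ⟨q, hq, hql⟩ := hG.1.exists_path_of_dist x b
    have hpq : (p.append q).IsPath :=
      Walk.isPath_of_length_eq_dist _ (by rw [Walk.length_append, hpl, hql, hx])
    rw [(hG.existsUnique_path a b).unique hw hpq, Walk.getVert_append, hpl]
    simp
  obtain ⟨w, hw, -⟩ := hG.1.exists_path_of_dist a b
  rw [← key x hx w hw, ← key y hy w hw, hxy]

/-- `p 0, …, p D` is a geodesic of `G`. -/
def IsGeodesicSeq (G : SimpleGraph V) (D : ℕ) (p : ℕ → V) : Prop :=
  ∀ x y, x ≤ D → y ≤ D → G.dist (p x) (p y) = (x - y) + (y - x)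

theorem IsGeodesicSeq.reverse {D : ℕ} {p : ℕ → V} (hp : IsGeodesicSeq G D p) :
    IsGeodesicSeq G D (fun x => p (D - x)) := by
  intro x y hx hy
  have := hp (D - x) (D - y) (by omega) (by omega)
  simp only [this]
  omega

theorem SimpleGraph.Connected.exists_isGeodesicSeq (hG : G.Connected) (a b : V) :
    ∃ p, IsGeodesicSeq G (G.dist a b) p ∧ p 0 = a ∧ p (G.dist a b) = b := by
  obtain ⟨w, hw⟩ := hG.exists_walk_length_eq_dist a b
  have key : ∀ x y, x ≤ y → y ≤ G.dist a b → G.dist (w.getVert x) (w.getVert y) = y - x := by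
    intro x y hxy hy
    have h1 := dist_le (w.take x)
    have h2 : G.dist (w.getVert x) (w.getVert y) ≤ ((w.drop x).take (y - x)).length := by
      convert dist_le ((w.drop x).take (y - x)) using 2
      rw [Walk.drop_getVert]; congr 1; omega
    have h3 := dist_le (w.drop y)
    rw [Walk.take_length] at h1 h2
    rw [Walk.drop_length] at h3
    have t1 := hG.dist_triangle (u := a) (v := w.getVert x) (w := b)
    have t2 := hG.dist_triangle (u := w.getVert x) (v := w.getVert y) (w := b)
    omega
  refine ⟨w.getVert, fun x y hx hy => ?_, by simp, by rw [← hw]; simp⟩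
  rcases le_total x y with h | h
  · rw [key x y h hy]; omega
  · rw [dist_comm, key y x h hx]; omega

/-- Gates: `i w` is the index of the vertex of the geodesic `p` nearest to `w`, and `h w` is the
distance of `w` to it. -/
structure IsGate (G : SimpleGraph V) (D : ℕ) (p : ℕ → V) (i h : V → ℕ) : Prop where
  le : ∀ w, i w ≤ D
  dist_path : ∀ w x, x ≤ D → G.dist w (p x) = h w + ((x - i w) + (i w - x))
  dist_of_ne : ∀ u w, i u ≠ i w → G.dist u w = h u + h w + ((i u - i w) + (i w - i u))
  dist_of_eq : ∀ u w, i u = i w → ∃ c, c ≤ h u ∧ c ≤ h w ∧ G.dist u w + 2 * c = h u + h w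

theorem IsGate.reverse {D : ℕ} {p : ℕ → V} {i h : V → ℕ} (hg : IsGate G D p i h) :
    IsGate G D (fun x => p (D - x)) (fun w => D - i w) h where
  le w := by omega
  dist_path w x hx := by
    have := hg.le w
    rw [hg.dist_path w _ (by omega)]; omega
  dist_of_ne u w huw := by
    have := hg.le w
    have := hg.le u
    rw [hg.dist_of_ne u w (by omega)]; omega
  dist_of_eq u w huw := by
    have := hg.le w
    have := hg.le u
    exact hg.dist_of_eq u w (by omega)

/-- The gate is a nearest path vertex. The geodesic to it meets the path only there, so distances to
the path add up; a route between vertices with different gates must pass through both gates. With a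
common gate, `c` is the distance from the gate to the median. -/
theorem IsGeodesicSeq.exists_isGate [Finite V] (hG : G.IsTree) {D : ℕ} {p : ℕ → V}
    (hp : IsGeodesicSeq G D p) : ∃ i h, IsGate G D p i h := by
  have H : ∀ w, ∃ i, i ≤ D ∧ ∀ x ≤ D, G.dist w (p i) ≤ G.dist w (p x) := by
    intro w
    obtain ⟨i, hi, h⟩ := Finset.exists_min_image (Finset.range (D + 1)) (fun x => G.dist w (p x))
      ⟨0, by simp⟩
    simp only [Finset.mem_range, Nat.lt_succ_iff] at hi h
    exact ⟨i, hi, h⟩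
  choose i hi hmin using H
  have tri := fun u v w => hG.1.dist_triangle (u := u) (v := v) (w := w)
  have comm := fun u v => G.dist_comm (u := u) (v := v)
  have P : ∀ w x, x ≤ D → G.dist w (p x) = G.dist w (p (i w)) + ((x - i w) + (i w - x)) := by
    intro w x hx
    rw [hG.dist_eq_add_of_forall w (p (i w)) (p x), hp _ _ (hi w) hx]
    · omega
    · intro z h1 h2
      have hd := hp (i w) x (hi w) hx
      obtain ⟨y, hy, e1⟩ : ∃ y ≤ D, G.dist (p (i w)) (p y) = G.dist (p (i w)) z ∧
          G.dist (p (i w)) (p y) + G.dist (p y) (p x) = G.dist (p (i w)) (p x) := by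
        have := hi w
        rcases le_total (i w) x with h | h
        · refine ⟨i w + G.dist (p (i w)) z, by omega, ?_⟩
          rw [hp _ _ (hi w) (by omega), hp _ _ (by omega) hx]; omega
        · refine ⟨i w - G.dist (p (i w)) z, by omega, ?_⟩
          rw [hp _ _ (hi w) (by omega), hp _ _ (by omega) hx]; omega
      have hz := hG.eq_of_between h2 e1.2 e1.1.symm
      subst hz
      have := hmin w y hy
      exact hG.1.dist_eq_zero_iff.1 (by omega)
  refine ⟨i, fun w => G.dist w (p (i w)), hi, P, ?_, ?_⟩
  · intro u w huw
    have hq := P u (i w) (hi w)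
    -- Every vertex between `w` and its gate has the same gate.
    have hgate : ∀ w z, G.dist w z + G.dist z (p (i w)) = G.dist w (p (i w)) → i z = i w := by
      intro w z hz
      have h1 := P w (i z) (hi z)
      have h2 := P z (i w) (hi w)
      have h3 := tri w z (p (i z))
      omega
    rw [hG.dist_eq_add_of_forall u (p (i w)) w, hq, comm (p (i w)) w]
    · omega
    · intro z h1 h2
      have hzw := hgate w z (by
        have := comm (p (i w)) z
        have := comm w z
        have := comm (p (i w)) w
        omega)
      have hpath := hp (i u) (i w) (hi u) (hi w)
      -- Past the gate of `u`, `z` lies on the path and hence is its own gate `p (i w)`. Before it,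
      -- `z` would have the gates of both `u` and `w`.
      rcases le_total (G.dist u (p (i u))) (G.dist u z) with hle | hle
      · obtain ⟨y, hy, e⟩ : ∃ y ≤ D, G.dist (p (i u)) (p y) + G.dist u (p (i u)) = G.dist u z ∧
            G.dist (p (i u)) (p y) + G.dist (p y) (p (i w)) = G.dist (p (i u)) (p (i w)) := by
          have := hi w
          have := hi u
          rcases le_total (i u) (i w) with h | h
          · refine ⟨i u + (G.dist u z - G.dist u (p (i u))), by omega, ?_⟩
            rw [hp _ _ (hi u) (by omega), hp _ _ (by omega) (hi w)]; omega
          · refine ⟨i u - (G.dist u z - G.dist u (p (i u))), by omega, ?_⟩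
            rw [hp _ _ (hi u) (by omega), hp _ _ (by omega) (hi w)]; omega
        have hy' := P u y hy
        have hd := hp (i u) y (hi u) hy
        have hzy : z = p y := hG.eq_of_between h1 (by omega) (by omega)
        have e1 := P z y hy
        rw [hzy, G.dist_self, ← hzy, hzw] at e1
        exact hG.1.dist_eq_zero_iff.1 (by rw [hzy, ← hzw, hp _ _ hy (hi z)]; omega)
      · exfalso
        obtain ⟨q, hgq, hq0, hq1⟩ := hG.1.exists_isGeodesicSeq u (p (i u))
        have e0 := hgq 0 (G.dist u z) (by omega) hle
        have e1 := hgq (G.dist u z) _ hle le_rfl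
        rw [hq0] at e0
        rw [hq1] at e1
        have hgz := hgate u (q (G.dist u z)) (by omega)
        have e2 := P (q (G.dist u z)) (i w) (hi w)
        rw [hgz] at e2
        have hz : z = q (G.dist u z) := hG.eq_of_between h1 (by omega) (by omega)
        rw [← hz] at hgz
        omega
  · intro u w huw
    obtain ⟨z, h1, h2, h3⟩ := hG.exists_median u (p (i u)) w
    simp only [← huw]
    refine ⟨G.dist (p (i u)) z, ?_, ?_, ?_⟩ <;>
    · have := comm (p (i u)) z
      have := comm (p (i u)) w
      have := comm z w
      omega

end TreeGeometry

/-! ### Gains and losses of a tree against its caterpillar. -/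

section Comparison

open SimpleGraph Finset

/-- Raising gate index and height together by 1 leaves the distances to `x > j + k` unchanged and
adds 2 to those with `x ≤ j + k`. The term `x = j + k` alone gives `g (k+3) - g (k+1)`; `x = j + k -
1`, present because `1 ≤ j`, makes the inequality strict. -/
theorem sum_dist_path_step {g : ℕ → ℝ} (hg : StrictMono g) {D j k : ℕ} (hj : 1 ≤ j)
    (hD : j + k + 1 ≤ D) :
    ∑ x ∈ range (D + 1), g (k + 1 + ((x - (j + k)) + (j + k - x))) + (g (k + 3) - g (k + 1)) <
      ∑ x ∈ range (D + 1), g (k + 2 + ((x - (j + k + 1)) + (j + k + 1 - x))) := by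
  rw [← sub_pos, ← sub_sub, ← sum_sub_distrib, sub_pos,
    ← add_sum_erase _ _ (show j + k ∈ range (D + 1) by simp; omega)]
  have e1 : k + 2 + (j + k - (j + k + 1) + (j + k + 1 - (j + k))) = k + 3 := by omega
  have e2 : k + 1 + (j + k - (j + k) + (j + k - (j + k))) = k + 1 := by omega
  rw [e1, e2, lt_add_iff_pos_right]
  refine sum_pos' (fun x _ => sub_nonneg.2 (hg.monotone (by omega)))
    ⟨j + k - 1, ?_, sub_pos.2 (hg (by omega))⟩
  simp only [mem_erase, mem_range]
  omega

theorem sum_dist_path_le {g : ℕ → ℝ} (hg : StrictMono g) {D j : ℕ} (hj : 1 ≤ j) (k : ℕ)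
    (hD : j + k ≤ D) :
    ∑ x ∈ range (D + 1), g (1 + ((x - j) + (j - x))) + ∑ a ∈ range k, (g (a + 3) - g (a + 1)) ≤
      ∑ x ∈ range (D + 1), g (k + 1 + ((x - (j + k)) + (j + k - x))) := by
  induction k with
  | zero => simp
  | succ k ih =>
    have := sum_dist_path_step hg hj hD
    have := ih (by omega)
    rw [sum_range_succ _ k]
    simp only [← add_assoc] at *
    linarith

theorem sum_dist_path_lt {g : ℕ → ℝ} (hg : StrictMono g) {D j : ℕ} (hj : 1 ≤ j) (k : ℕ)
    (hD : j + k + 1 ≤ D) :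
    ∑ x ∈ range (D + 1), g (1 + ((x - j) + (j - x))) +
        ∑ a ∈ range (k + 1), (g (a + 3) - g (a + 1)) <
      ∑ x ∈ range (D + 1), g (k + 2 + ((x - (j + k + 1)) + (j + k + 1 - x))) := by
  have := sum_dist_path_step hg hj hD
  have := sum_dist_path_le hg (D := D) hj k (by omega)
  rw [sum_range_succ _ k]
  linarith

theorem sum_range_reflect_dist (f : ℕ → ℝ) {D i : ℕ} (hi : i ≤ D) :
    ∑ x ∈ range (D + 1), f ((x - i) + (i - x)) =
      ∑ x ∈ range (D + 1), f ((x - min i (D - i)) + (min i (D - i) - x)) := by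
  rcases le_total i (D - i) with h | h
  · rw [min_eq_left h]
  · rw [min_eq_right h, ← sum_range_reflect]
    refine sum_congr rfl fun x hx => congrArg f ?_
    rw [mem_range] at hx
    omega

variable {V : Type u} {G : SimpleGraph V} {D : ℕ} {p : ℕ → V} {i h : V → ℕ}

/-- The index of the path vertex of the caterpillar that carries the pendent vertices with the same
eccentricity as a vertex with gate index `i` at height `h`. -/
def foot (D : ℕ) (i h : V → ℕ) (w : V) : ℕ := 1 + min (i w) (D - i w) - h w

/-- A higher branch would make `w` farther than `D` from an end of the path. -/
theorem IsGate.height_le (hg : IsGate G D p i h) (hD : ∀ u v, G.dist u v ≤ D) (w : V) :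
    h w ≤ i w ∧ h w ≤ D - i w := by
  have h1 := hg.dist_path w 0 (by omega)
  have h2 := hg.dist_path w D le_rfl
  have h3 := hD w (p 0)
  have h4 := hD w (p D)
  have h5 := hg.le w
  omega

/-- `u` lies strictly between `w` and the gate of `w`. -/
def IsStrictAncestor (G : SimpleGraph V) (i h : V → ℕ) (u w : V) : Prop :=
  i u = i w ∧ h u < h w ∧ G.dist u w + h u = h w

/-- With a common gate, the feet differ by the difference of the heights, and the branches part
strictly below both vertices, which costs the extra 2. With different gates, both heights are at
least 1 and `min (i w) (D - i w)` is 1-Lipschitz in the gate index. -/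
theorem IsGate.foot_dist_le_of_not_isStrictAncestor (hg : IsGate G D p i h)
    (hD : ∀ u v, G.dist u v ≤ D) (hG : G.Connected) {u w : V} (hu : 0 < h u) (hw : 0 < h w)
    (huw : u ≠ w) (h1 : ¬ IsStrictAncestor G i h u w) (h2 : ¬ IsStrictAncestor G i h w u) :
    2 + ((foot D i h u - foot D i h w) + (foot D i h w - foot D i h u)) ≤ G.dist u w := by
  have a1 := hg.height_le hD u
  have a2 := hg.height_le hD w
  have b1 := hg.le u
  have b2 := hg.le w
  have hpos := hG.pos_dist_of_ne huw
  unfold foot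
  by_cases e : i u = i w
  · obtain ⟨c, c1, c2, c3⟩ := hg.dist_of_eq u w e
    rw [IsStrictAncestor, not_and, not_and] at h1 h2
    have h1 := h1 e
    have h2 := h2 e.symm
    rw [G.dist_comm] at h2
    omega
  · have := hg.dist_of_ne u w e
    omega

theorem IsGate.dist_of_isStrictAncestor (hg : IsGate G D p i h)
    (hD : ∀ u v, G.dist u v ≤ D) {u w : V} (hu : IsStrictAncestor G i h u w) :
    2 + ((foot D i h u - foot D i h w) + (foot D i h w - foot D i h u)) = G.dist u w + 2 := by
  have a1 := hg.height_le hD u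
  have a2 := hg.height_le hD w
  obtain ⟨h1, h2, h3⟩ := hu
  unfold foot
  omega

theorem IsGate.isStrictAncestor_ext (hg : IsGate G D p i h) (hG : G.IsTree) {u v w : V}
    (hu : IsStrictAncestor G i h u w) (hv : IsStrictAncestor G i h v w) (huv : h u = h v) :
    u = v := by
  obtain ⟨h1, h2, h3⟩ := hu
  obtain ⟨k1, k2, k3⟩ := hv
  have e1 := hg.dist_path u (i w) (hg.le w)
  have e2 := hg.dist_path v (i w) (hg.le w)
  have e3 := hg.dist_path w (i w) (hg.le w)
  have c1 := G.dist_comm (u := u) (v := w)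
  have c2 := G.dist_comm (u := v) (v := w)
  exact hG.eq_of_between (a := w) (b := p (i w)) (by omega) (by omega) (by omega)

open Classical in
/-- The loss, caused by a vertex `u` between `w` and its gate, in comparison to the caterpillar. -/
noncomputable def ancestorLoss (G : SimpleGraph V) (i h : V → ℕ) (g : ℕ → ℝ) (u w : V) : ℝ :=
  if IsStrictAncestor G i h u w then g (G.dist u w + 2) - g (G.dist u w) else 0

theorem ancestorLoss_nonneg {g : ℕ → ℝ} (hm : StrictMono g) (u w : V) :
    0 ≤ ancestorLoss G i h g u w := by
  unfold ancestorLoss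
  split_ifs
  · exact sub_nonneg.2 (hm.monotone (by omega))
  · exact le_rfl

/-- There is at most one ancestor at each height. An ancestor at distance `a + 1` loses `g (a+3) - g
(a+1)`, with `a = h w - h u - 1` below `h w - 1` since `h u` is positive. -/
theorem IsGate.sum_ancestorLoss_le [Fintype V] (hg : IsGate G D p i h) (hG : G.IsTree) {g : ℕ → ℝ}
    (hm : StrictMono g) (w : V) :
    ∑ u : {u : V // 0 < h u}, ancestorLoss G i h g u w ≤
      ∑ a ∈ range (h w - 1), (g (a + 3) - g (a + 1)) := by
  classical
  unfold ancestorLoss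
  rw [← sum_filter]
  have hinj : Set.InjOn (fun u : {u : V // 0 < h u} => h w - h u - 1)
      (univ.filter fun u : {u : V // 0 < h u} => IsStrictAncestor G i h u w) := by
    intro u hu v hv huv
    simp only [coe_filter, mem_univ, true_and, Set.mem_ofPred_eq] at hu hv huv
    have := hu.2.1
    have := hv.2.1
    exact Subtype.ext (hg.isStrictAncestor_ext hG hu hv (by omega))
  calc _ = ∑ u ∈ univ.filter fun u : {u : V // 0 < h u} => IsStrictAncestor G i h u w,
        (g (h w - h u - 1 + 3) - g (h w - h u - 1 + 1)) := by
        refine sum_congr rfl fun u hu => ?_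
        simp only [mem_filter, mem_univ, true_and] at hu
        obtain ⟨-, h2, h3⟩ := hu
        congr 2 <;> omega
    _ = ∑ a ∈ (univ.filter fun u : {u : V // 0 < h u} => IsStrictAncestor G i h u w).image
        (fun u : {u : V // 0 < h u} => h w - h u - 1),
        (g (a + 3) - g (a + 1)) := (sum_image (f := fun a => g (a + 3) - g (a + 1)) hinj).symm
    _ ≤ _ := by
        refine sum_le_sum_of_subset_of_nonneg ?_
          fun a _ _ => sub_nonneg.2 (hm.monotone (by omega))
        intro a ha
        simp only [mem_image, mem_filter, mem_univ, true_and] at ha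
        obtain ⟨u, hu, rfl⟩ := ha
        have := hu.2.1
        have := u.2
        rw [mem_range]
        omega

/-- The difference of the contributions of the path vertices to the distances from `w` in the tree
and from a pendent vertex of the caterpillar. -/
noncomputable def pathGain (G : SimpleGraph V) (D : ℕ) (p : ℕ → V) (i h : V → ℕ) (g : ℕ → ℝ)
    (w : V) : ℝ :=
  ∑ x : Fin (D + 1),
    (g (G.dist w (p x)) - g (1 + ((x.val - foot D i h w) + (foot D i h w - x.val))))

theorem IsGate.pathGain_eq (hg : IsGate G D p i h) {g : ℕ → ℝ} {w : V} :
    pathGain G D p i h g w =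
      ∑ x ∈ range (D + 1), g (h w + ((x - min (i w) (D - i w)) + (min (i w) (D - i w) - x))) -
      ∑ x ∈ range (D + 1), g (1 + ((x - foot D i h w) + (foot D i h w - x))) := by
  rw [pathGain, Fin.sum_univ_eq_sum_range
    (fun x => g (G.dist w (p x)) - g (1 + ((x - foot D i h w) + (foot D i h w - x)))),
    sum_sub_distrib, ← sum_range_reflect_dist (fun y => g (h w + y)) (hg.le w)]
  congr 1
  refine sum_congr rfl fun x hx => ?_
  rw [hg.dist_path w x (by rw [mem_range] at hx; omega)]

theorem IsGate.sum_ancestorLoss_le_pathGain [Fintype V] (hg : IsGate G D p i h) (hG : G.IsTree)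
    (hD : ∀ u v, G.dist u v ≤ D) {g : ℕ → ℝ} (hm : StrictMono g) {w : V} (hw : 0 < h w) :
    ∑ u : {u : V // 0 < h u}, ancestorLoss G i h g u w ≤ pathGain G D p i h g w := by
  refine (hg.sum_ancestorLoss_le hG hm w).trans ?_
  have := hg.height_le hD w
  have := sum_dist_path_le hm (j := foot D i h w) (D := D) (by unfold foot; omega) (h w - 1)
    (by unfold foot; omega)
  rw [hg.pathGain_eq]
  have e1 : foot D i h w + (h w - 1) = min (i w) (D - i w) := by unfold foot; omega
  have e2 : h w - 1 + 1 = h w := by omega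
  rw [e1, e2] at this
  linarith

theorem IsGate.sum_ancestorLoss_lt_pathGain [Fintype V] (hg : IsGate G D p i h) (hG : G.IsTree)
    (hD : ∀ u v, G.dist u v ≤ D) {g : ℕ → ℝ} (hm : StrictMono g) {w : V} (hw : 2 ≤ h w) :
    ∑ u : {u : V // 0 < h u}, ancestorLoss G i h g u w < pathGain G D p i h g w := by
  refine (hg.sum_ancestorLoss_le hG hm w).trans_lt ?_
  have := hg.height_le hD w
  -- Climbing from height 1 to height `h w` takes `h w - 1` steps, at least one here, and each is
  -- strict.
  have := sum_dist_path_lt hm (j := foot D i h w) (D := D) (by unfold foot; omega) (h w - 2)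
    (by unfold foot; omega)
  rw [hg.pathGain_eq]
  have e1 : foot D i h w + (h w - 2) + 1 = min (i w) (D - i w) := by unfold foot; omega
  have e2 : h w - 2 + 2 = h w := by omega
  have e3 : h w - 2 + 1 = h w - 1 := by omega
  rw [e1, e2, e3] at this
  linarith

open Classical in
/-- The distance of two pendent vertices of the caterpillar. -/
noncomputable def pendentDist (D : ℕ) (i h : V → ℕ) (u w : V) : ℕ :=
  if u = w then 0 else 2 + ((foot D i h u - foot D i h w) + (foot D i h w - foot D i h u))

/-- For an ancestor pair the added loss is exactly the deficit; any other pair has no deficit. -/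
theorem IsGate.pendent_gain_nonneg (hg : IsGate G D p i h) (hG : G.IsTree)
    (hD : ∀ u v, G.dist u v ≤ D) {g : ℕ → ℝ} (hm : StrictMono g) {u w : V} (hu : 0 < h u)
    (hw : 0 < h w) :
    0 ≤ g (G.dist u w) - g (pendentDist D i h u w) +
      ancestorLoss G i h g u w + ancestorLoss G i h g w u := by
  have n1 := ancestorLoss_nonneg (G := G) (i := i) (h := h) hm u w
  have n2 := ancestorLoss_nonneg (G := G) (i := i) (h := h) hm w u
  by_cases huw : u = w
  · subst huw
    simp only [pendentDist, if_true, dist_self]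
    linarith
  rw [pendentDist, if_neg huw]
  by_cases h1 : IsStrictAncestor G i h u w
  · rw [hg.dist_of_isStrictAncestor hD h1]
    have : ancestorLoss G i h g u w = _ := if_pos h1
    linarith
  by_cases h2 : IsStrictAncestor G i h w u
  · have e := hg.dist_of_isStrictAncestor hD h2
    rw [add_comm (foot D i h w - foot D i h u), G.dist_comm] at e
    rw [e]
    have : ancestorLoss G i h g w u = _ := if_pos h2
    rw [G.dist_comm] at this
    linarith
  have := hm.monotone (hg.foot_dist_le_of_not_isStrictAncestor hD hG.1 hu hw huw h1 h2)
  linarith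

/-- The total gain of a tree over the caterpillar. -/
noncomputable def totalGain [Fintype V] (G : SimpleGraph V) (D : ℕ) (p : ℕ → V) (i h : V → ℕ)
    (g : ℕ → ℝ) : ℝ :=
  2 * ∑ w : {w : V // 0 < h w}, pathGain G D p i h g w +
    ∑ u : {u : V // 0 < h u}, ∑ w : {w : V // 0 < h w},
      (g (G.dist (u : V) w) - g (pendentDist D i h u w))

/-- The charging argument: each ancestor loss is taken from the path gain of the lower vertex and
given to the pair. Ordered pairs count it twice, matching the factor 2. -/
theorem totalGain_eq [Fintype V] (g : ℕ → ℝ) :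
    totalGain G D p i h g =
      2 * ∑ w : {w : V // 0 < h w},
        (pathGain G D p i h g w - ∑ u : {u : V // 0 < h u}, ancestorLoss G i h g u w) +
      ∑ u : {u : V // 0 < h u}, ∑ w : {w : V // 0 < h w},
        (g (G.dist (u : V) w) - g (pendentDist D i h u w) +
          ancestorLoss G i h g u w + ancestorLoss G i h g w u) := by
  simp only [totalGain, sum_add_distrib, sum_sub_distrib]
  rw [sum_comm (f := fun (u : {u : V // 0 < h u}) (w : {w : V // 0 < h w}) =>
    ancestorLoss G i h g u w)]
  ring

theorem IsGate.totalGain_nonneg [Fintype V] (hg : IsGate G D p i h) (hG : G.IsTree)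
    (hD : ∀ u v, G.dist u v ≤ D) {g : ℕ → ℝ} (hm : StrictMono g) :
    0 ≤ totalGain G D p i h g := by
  rw [totalGain_eq]
  refine add_nonneg (mul_nonneg (by norm_num) (sum_nonneg fun w _ => sub_nonneg.2 ?_))
    (sum_nonneg fun u _ => sum_nonneg fun w _ => ?_)
  · exact hg.sum_ancestorLoss_le_pathGain hG hD hm w.2
  · exact hg.pendent_gain_nonneg hG hD hm u.2 w.2

/-- Every nonnegative term vanishes. Strict path gain at height 2 or more forces height at most 1,
so no ancestor losses remain and injectivity of `g` recovers the distances. -/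
theorem IsGate.of_totalGain_eq_zero [Fintype V] (hg : IsGate G D p i h) (hG : G.IsTree)
    (hD : ∀ u v, G.dist u v ≤ D) {g : ℕ → ℝ} (hm : StrictMono g)
    (h0 : totalGain G D p i h g = 0) :
    (∀ w, h w ≤ 1) ∧ ∀ u w, 0 < h u → 0 < h w → G.dist u w = pendentDist D i h u w := by
  rw [totalGain_eq] at h0
  have A : ∀ w ∈ (univ : Finset {w : V // 0 < h w}), 0 ≤
      pathGain G D p i h g w - ∑ u : {u : V // 0 < h u}, ancestorLoss G i h g u w :=
    fun w _ => sub_nonneg.2 (hg.sum_ancestorLoss_le_pathGain hG hD hm w.2)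
  have B : ∀ u w : {w : V // 0 < h w}, 0 ≤ g (G.dist (u : V) w) - g (pendentDist D i h u w) +
      ancestorLoss G i h g u w + ancestorLoss G i h g w u :=
    fun u w => hg.pendent_gain_nonneg hG hD hm u.2 w.2
  have hA := sum_nonneg A
  have hB := sum_nonneg fun u (_ : u ∈ univ) => sum_nonneg fun w (_ : w ∈ univ) => B u w
  have hA0 := (sum_eq_zero_iff_of_nonneg A).1 (by linarith)
  have hB0 := (sum_eq_zero_iff_of_nonneg fun u (_ : u ∈ univ) =>
    sum_nonneg fun w (_ : w ∈ univ) => B u w).1 (by linarith)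
  have hle : ∀ w, h w ≤ 1 := by
    intro w
    by_contra! hw
    have h1 := hA0 ⟨w, by omega⟩ (mem_univ _)
    have h2 := hg.sum_ancestorLoss_lt_pathGain hG hD hm hw
    simp only at h1
    linarith
  refine ⟨hle, fun u w hu hw => hm.injective ?_⟩
  have h1 := (sum_eq_zero_iff_of_nonneg fun w _ => B ⟨u, hu⟩ w).1
    (hB0 ⟨u, hu⟩ (mem_univ _)) ⟨w, hw⟩ (mem_univ _)
  have n : ∀ u w : V, 0 < h u → ancestorLoss G i h g u w = 0 := fun u w hu => if_neg fun h' => by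
    have := h'.2.1
    have := hle w
    omega
  simp only at h1
  rw [n u w hu, n w u hw] at h1
  linarith

end Comparison

/-! ### Criteria for distances, acyclicity, eccentricity and diameter. -/

section GeneralGraphs

open SimpleGraph

variable {V : Type u} {G : SimpleGraph V}

/-- A function that is `1`-Lipschitz, vanishes at `y` and decreases along some edge at every other
vertex is the distance to `y`. -/
theorem SimpleGraph.reachable_and_dist_eq_of_descent {y : V} (f : V → ℕ) (h0 : f y = 0)
    (hlip : ∀ a b, G.Adj a b → f a ≤ f b + 1)
    (hdesc : ∀ a, a ≠ y → ∃ b, G.Adj a b ∧ f b + 1 = f a) (a : V) :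
    G.Reachable a y ∧ G.dist a y = f a := by
  have upper : ∀ n a, f a = n → ∃ w : G.Walk a y, w.length = n := by
    intro n
    induction n with
    | zero =>
      intro a ha
      by_cases hay : a = y
      · subst hay; exact ⟨.nil, rfl⟩
      · obtain ⟨b, -, hb⟩ := hdesc a hay; omega
    | succ n ih =>
      intro a ha
      obtain ⟨b, hab, hb⟩ := hdesc a (by rintro rfl; omega)
      obtain ⟨w, hw⟩ := ih b (by omega)
      exact ⟨.cons hab w, by simp [hw]⟩
  have lower : ∀ a b (w : G.Walk a b), f a ≤ f b + w.length := by
    intro a b w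
    induction w with
    | nil => simp
    | cons hab w ih =>
      have := hlip _ _ hab
      rw [Walk.length_cons]
      omega
  obtain ⟨w, hw⟩ := upper _ a rfl
  refine ⟨⟨w⟩, le_antisymm (hw ▸ dist_le w) ?_⟩
  obtain ⟨w', hw'⟩ := Reachable.exists_walk_length_eq_dist ⟨w⟩
  have := lower _ _ w'
  omega

/-- A graph is acyclic if its vertices can be ranked so that each has at most one neighbour of rank
not above its own. -/
theorem SimpleGraph.isAcyclic_of_rank (f : V → ℕ)
    (hf : ∀ a b c, G.Adj a b → G.Adj a c → f b ≤ f a → f c ≤ f a → b = c) : G.IsAcyclic := by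
  classical
  intro v w hw
  -- At a vertex of highest rank on a cycle, its two distinct neighbours on the cycle contradict
  -- `hf`.
  obtain ⟨a, ha, hmax⟩ := Finset.exists_max_image w.support.toFinset f ⟨v, by simp⟩
  simp only [List.mem_toFinset] at ha hmax
  have hc := (Walk.isCycle_rotate ha).2 hw
  have hmem : ∀ b ∈ (w.rotate a ha).support, f b ≤ f a := fun b hb =>
    hmax b ((Walk.mem_support_rotate_iff _ _ _).1 hb)
  refine hc.snd_ne_penultimate (hf a _ _ (Walk.adj_snd hc.not_nil)
    (Walk.adj_penultimate hc.not_nil).symm (hmem _ ?_) (hmem _ ?_))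
  · exact Walk.getVert_mem_support _ _
  · exact Walk.getVert_mem_support _ _

theorem SimpleGraph.Connected.eccent_eq [Finite V] (hG : G.Connected) {v : V} {e : ℕ}
    (h1 : ∀ u, G.dist v u ≤ e) (h2 : ∃ u, G.dist v u = e) : ecc G v = e := by
  have : G.eccent v = e := by
    refine le_antisymm ((eccent_le_iff _ _).2 fun u => ?_) ?_
    · rw [← (hG v u).coe_dist_eq_edist]; exact_mod_cast h1 u
    · obtain ⟨u, rfl⟩ := h2
      rw [(hG v u).coe_dist_eq_edist]; exact edist_le_eccent
  rw [ecc, this, ENat.toNat_natCast]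

theorem SimpleGraph.Connected.diam_eq [Finite V] (hG : G.Connected) {D : ℕ}
    (h1 : ∀ u v, G.dist u v ≤ D) (h2 : ∃ u v, G.dist u v = D) : G.diam = D := by
  have := hG.nonempty
  refine le_antisymm ?_ ?_
  · obtain ⟨u, v, h⟩ := G.exists_dist_eq_diam
    rw [← h]; exact h1 u v
  · obtain ⟨u, v, rfl⟩ := h2
    exact dist_le_diam (connected_iff_ediam_ne_top.1 hG)

end GeneralGraphs

/-! ### Metric and eccentricities of the caterpillar. -/

section Caterpillar

open SimpleGraph

variable {r : ℕ} {m : List ℕ}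

/-- The index of the path vertex that carries a pendent vertex of the caterpillar. -/
def catFoot (c : Σ i : Fin m.length, Fin (m.get i - 2)) : ℕ := m.length - c.1.val

theorem one_le_catFoot (c : Σ i : Fin m.length, Fin (m.get i - 2)) : 1 ≤ catFoot c := by
  have := c.1.2
  unfold catFoot
  omega

theorem catFoot_le (c : Σ i : Fin m.length, Fin (m.get i - 2)) : catFoot c ≤ m.length := by
  unfold catFoot
  omega

theorem catTree_adj_inl_inl (x y : Fin (r + m.length + 1)) :
    (catTree r m).Adj (.inl x) (.inl y) ↔ x.val + 1 = y.val ∨ y.val + 1 = x.val := by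
  simp only [catTree, fromRel_adj, ne_eq, Sum.inl.injEq, and_iff_right_iff_imp]
  rintro h rfl
  omega

theorem catTree_adj_inl_inr (x : Fin (r + m.length + 1))
    (c : Σ i : Fin m.length, Fin (m.get i - 2)) :
    (catTree r m).Adj (.inl x) (.inr c) ↔ x.val = catFoot c := by
  simp [catTree, fromRel_adj, catFoot]

theorem catTree_adj_inr_inl (x : Fin (r + m.length + 1))
    (c : Σ i : Fin m.length, Fin (m.get i - 2)) :
    (catTree r m).Adj (.inr c) (.inl x) ↔ x.val = catFoot c := by
  rw [adj_comm, catTree_adj_inl_inr]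

theorem catTree_not_adj_inr_inr (c d : Σ i : Fin m.length, Fin (m.get i - 2)) :
    ¬ (catTree r m).Adj (.inr c) (.inr d) := by
  simp [catTree, fromRel_adj]

/-- The explicit distance function of the caterpillar. -/
def catDist : CatVertex r m → CatVertex r m → ℕ
  | .inl x, .inl y => (x.val - y.val) + (y.val - x.val)
  | .inl x, .inr c => 1 + ((x.val - catFoot c) + (catFoot c - x.val))
  | .inr c, .inl x => 1 + ((x.val - catFoot c) + (catFoot c - x.val))
  | .inr c, .inr d => if c = d then 0 else 2 + ((catFoot c - catFoot d) + (catFoot d - catFoot c))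

theorem catDist_le_of_adj (y a b : CatVertex r m) (hab : (catTree r m).Adj a b) :
    catDist a y ≤ catDist b y + 1 := by
  rcases a with a | a <;> rcases b with b | b <;>
    simp only [catTree_adj_inl_inl, catTree_adj_inl_inr, catTree_adj_inr_inl,
      catTree_not_adj_inr_inr] at hab <;> rcases y with y | y <;> simp only [catDist]
  · omega
  · omega
  · omega
  · split_ifs with h
    · subst h; omega
    · omega
  · omega
  · split_ifs with h
    · omega
    · omega

theorem exists_adj_inl_catDist (x : Fin (r + m.length + 1)) (z : ℕ) (hz : z ≤ r + m.length)
    (hxz : x.val ≠ z) : ∃ y : Fin (r + m.length + 1), (catTree r m).Adj (.inl x) (.inl y) ∧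
      (y.val - z) + (z - y.val) + 1 = (x.val - z) + (z - x.val) := by
  simp only [catTree_adj_inl_inl]
  have := x.2
  rcases Nat.lt_or_gt_of_ne hxz with h | h
  · exact ⟨⟨x.val + 1, by omega⟩, .inl rfl, by simp only; omega⟩
  · exact ⟨⟨x.val - 1, by omega⟩, .inr (by simp only; omega), by simp only; omega⟩

theorem exists_adj_catDist (y a : CatVertex r m) (hay : a ≠ y) :
    ∃ b, (catTree r m).Adj a b ∧ catDist b y + 1 = catDist a y := by
  rcases a with a | a
  · rcases y with y | y
    · obtain ⟨b, h1, h2⟩ := exists_adj_inl_catDist a y.val (by omega)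
        fun h => hay (congrArg _ (Fin.ext h))
      exact ⟨.inl b, h1, h2⟩
    · by_cases h : a.val = catFoot y
      · exact ⟨.inr y, (catTree_adj_inl_inr _ _).2 h, by simp [catDist, h]⟩
      · have := catFoot_le y
        obtain ⟨b, h1, h2⟩ := exists_adj_inl_catDist a (catFoot y) (by omega) h
        exact ⟨.inl b, h1, by simp only [catDist]; omega⟩
  · have := catFoot_le a
    refine ⟨.inl ⟨catFoot a, by omega⟩, (catTree_adj_inr_inl _ _).2 rfl, ?_⟩
    rcases y with y | y
    · simp only [catDist]; omega
    · have h : a ≠ y := fun h => hay (congrArg _ h)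
      simp only [catDist, if_neg h]; omega

theorem catTree_dist (a y : CatVertex r m) : (catTree r m).dist a y = catDist a y := by
  refine (reachable_and_dist_eq_of_descent (y := y) (fun a => catDist a y) ?_
    (fun a b => catDist_le_of_adj y a b) (exists_adj_catDist y) a).2
  rcases y with y | y <;> simp [catDist]

theorem catTree_connected : (catTree r m).Connected where
  preconnected a y := by
    refine (reachable_and_dist_eq_of_descent (y := y) (fun a => catDist a y) ?_
      (fun a b => catDist_le_of_adj y a b) (exists_adj_catDist y) a).1
    rcases y with y | y <;> simp [catDist]
  nonempty := ⟨.inl 0⟩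

theorem catTree_isTree : (catTree r m).IsTree where
  connected := catTree_connected
  isAcyclic := by
    -- Pendent vertices rank above the whole path, so a path vertex has only its predecessor as a
    -- neighbour of no higher rank.
    refine isAcyclic_of_rank (Sum.elim (fun x => x.val) fun _ => r + m.length + 1) ?_
    intro a b c hab hac hb hc
    rcases a with a | a <;> rcases b with b | b <;> rcases c with c | c <;>
      simp only [catTree_adj_inl_inl, catTree_adj_inl_inr, catTree_adj_inr_inl,
        catTree_not_adj_inr_inr, Sum.elim_inl, Sum.elim_inr] at hab hac hb hc
    · exact congrArg _ (Fin.ext (by omega))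
    · omega
    · omega
    · omega
    · exact congrArg _ (Fin.ext (by omega))

theorem catTree_dist_le (hm : m.length ≤ r) (a b : CatVertex r m) :
    (catTree r m).dist a b ≤ r + m.length := by
  rw [catTree_dist]
  have := fun c : Σ i : Fin m.length, Fin (m.get i - 2) => one_le_catFoot c
  have := fun c : Σ i : Fin m.length, Fin (m.get i - 2) => catFoot_le c
  rcases a with a | a <;> rcases b with b | b <;> simp only [catDist]
  · omega
  · grind
  · grind
  · split_ifs
    · omega
    · grind

theorem catTree_diam (hm : m.length ≤ r) : (catTree r m).diam = r + m.length :=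
  catTree_connected.diam_eq (catTree_dist_le hm) ⟨.inl ⟨0, by omega⟩, .inl ⟨r + m.length, by omega⟩,
    by rw [catTree_dist]; simp [catDist]⟩

/-- Feet are interior path vertices, so a pendent vertex is never farther than the path end behind
it. -/
theorem ecc_catTree_inl (hm : m.length ≤ r) (x : Fin (r + m.length + 1)) :
    ecc (catTree r m) (.inl x) = max x.val (r + m.length - x.val) := by
  refine catTree_connected.eccent_eq ?_ ?_
  · rintro (y | c)
    · rw [catTree_dist]; simp only [catDist]; omega
    · rw [catTree_dist]; simp only [catDist]
      have := one_le_catFoot c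
      have := catFoot_le c
      omega
  · rcases le_total x.val (r + m.length - x.val) with h | h
    · exact ⟨.inl ⟨r + m.length, by omega⟩, by rw [catTree_dist]; simp only [catDist]; omega⟩
    · exact ⟨.inl ⟨0, by omega⟩, by rw [catTree_dist]; simp only [catDist]; omega⟩

/-- All feet lie in the half towards index 0, so the other end of the path is farthest. -/
theorem ecc_catTree_inr (hm : m.length ≤ r) (c : Σ i : Fin m.length, Fin (m.get i - 2)) :
    ecc (catTree r m) (.inr c) = r + m.length + 1 - catFoot c := by
  have := one_le_catFoot c
  have := catFoot_le c
  refine catTree_connected.eccent_eq ?_ ⟨.inl ⟨r + m.length, by omega⟩, ?_⟩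
  · rintro (y | d)
    · rw [catTree_dist]; simp only [catDist]; omega
    · rw [catTree_dist]; simp only [catDist]
      have := one_le_catFoot d
      have := catFoot_le d
      split_ifs <;> omega
  · rw [catTree_dist]; simp only [catDist]; omega

end Caterpillar

/-! ### Index sums over ordered pairs, and eccentric sequences as counts. -/

section WienerSums

open SimpleGraph Finset

variable {V : Type u}

theorem sum_filter_not_isDiag_two_mul [Fintype V] [DecidableEq V] (f : Sym2 V → ℝ) :
    2 * ∑ e ∈ (univ : Finset (Sym2 V)).filter (fun e => ¬ e.IsDiag), f e =
      ∑ x ∈ (univ : Finset V).offDiag, f s(x.1, x.2) := by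
  rw [← sum_fiberwise_of_maps_to (t := (univ : Finset (Sym2 V)).filter (fun e => ¬ e.IsDiag))
    (g := fun x : V × V => s(x.1, x.2)) (fun x hx => by simpa using hx), mul_sum]
  refine sum_congr rfl fun e he => ?_
  induction e using Sym2.ind with
  | _ a b =>
    have hab : a ≠ b := by simpa using he
    have : ((univ : Finset V).offDiag.filter fun x => s(x.1, x.2) = s(a, b)) =
        {(a, b), (b, a)} := by
      ext ⟨x, y⟩
      simp only [mem_filter, mem_offDiag, mem_univ, true_and, Sym2.eq_iff, mem_insert,
        mem_singleton, Prod.mk.injEq]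
      grind
    rw [this, sum_pair (by simp [hab])]
    rw [Sym2.eq_swap (a := b)]
    ring

/-- The diagonal contributes `g 0` per vertex, which cancels when graphs of equal order are
compared. -/
theorem two_mul_wienerType_add [Fintype V] [DecidableEq V] (G : SimpleGraph V) (g : ℕ → ℝ) :
    2 * wienerType G g + Fintype.card V * g 0 = ∑ u, ∑ v, g (G.dist u v) := by
  rw [wienerType, sum_filter_not_isDiag_two_mul, ← Fintype.sum_prod_type', ← univ_product_univ,
    ← diag_union_offDiag, sum_union (disjoint_diag_offDiag _), sum_diag]
  simp [add_comm]

theorem wienerType_congr [Fintype V] [DecidableEq V] {G : SimpleGraph V} {D : ℕ}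
    (hD : ∀ u v, G.dist u v ≤ D) {f g : ℕ → ℝ} (hfg : ∀ x ≤ D, f x = g x) :
    wienerType G f = wienerType G g := by
  refine sum_congr rfl fun e _ => ?_
  induction e using Sym2.ind with
  | _ a b => exact hfg _ (hD a b)

theorem SimpleGraph.Iso.dist_le {W : Type*} {G : SimpleGraph V} {H : SimpleGraph W} (φ : G ≃g H)
    (hG : G.Connected) (u v : V) : H.dist (φ u) (φ v) ≤ G.dist u v := by
  obtain ⟨w, hw⟩ := hG.exists_walk_length_eq_dist u v
  rw [← hw, ← Walk.length_map φ.toHom w]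
  exact SimpleGraph.dist_le (w.map φ.toHom)

theorem SimpleGraph.Iso.dist_eq {W : Type*} {G : SimpleGraph V} {H : SimpleGraph W} (φ : G ≃g H)
    (hG : G.Connected) (u v : V) : H.dist (φ u) (φ v) = G.dist u v := by
  refine le_antisymm (φ.dist_le hG u v) ?_
  have := φ.symm.dist_le (φ.connected_iff.1 hG) (φ u) (φ v)
  simpa using this

theorem exists_equiv_sigma_fin {α : Type*} [Fintype α] {n : ℕ} (k : α → Fin n) (c : Fin n → ℕ)
    (hc : ∀ j, (univ.filter fun a => k a = j).card = c j) :
    ∃ e : α ≃ Σ j, Fin (c j), ∀ a, (e a).1 = k a := by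
  have E : ∀ j, Nonempty ({a // k a = j} ≃ Fin (c j)) := fun j =>
    ⟨Fintype.equivFinOfCardEq (by rw [Fintype.card_subtype, hc])⟩
  refine ⟨(Equiv.sigmaFiberEquiv k).symm.trans (Equiv.sigmaCongrRight fun j => (E j).some), ?_⟩
  intro a
  rfl

theorem count_eccentricSequence [Fintype V] (G : SimpleGraph V) (b : ℕ) :
    (eccentricSequence G).count b = (univ.filter fun v => ecc G v = b).card := by
  classical
  rw [eccentricSequence, ← Multiset.coe_count, Multiset.sort_eq, Multiset.count_map, card_def,
    filter_val]
  congr 2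
  ext v
  exact eq_comm

theorem mem_eccentricSequence [Fintype V] (G : SimpleGraph V) (b : ℕ) :
    b ∈ eccentricSequence G ↔ ∃ v, ecc G v = b := by
  simp [eccentricSequence]

theorem eccentricSequence_congr {W : Type*} [Fintype V] [Fintype W] {G : SimpleGraph V}
    {H : SimpleGraph W} (e : V ≃ W) (he : ∀ v, ecc H (e v) = ecc G v) :
    eccentricSequence H = eccentricSequence G := by
  unfold eccentricSequence
  congr 1
  rw [← Finset.map_univ_equiv e, map_val, Multiset.map_map]
  exact Multiset.map_congr rfl fun v _ => he v

theorem distinctValues_eq {S : List ℕ} {a b : ℕ} (hS : ∀ x, x ∈ S ↔ a ≤ x ∧ x < a + b) :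
    distinctValues S = List.range' a b := by
  have : S.toFinset = (List.range' a b).toFinset := by
    ext x
    simp [hS]
  rw [distinctValues, this]
  exact (List.toFinset_sort _ List.nodup_range').2 (by
    exact (List.pairwise_lt_range').imp fun h => h.le)

end WienerSums

/-! ### Matching the vertices of a tree with those of its caterpillar. -/

section Bijection

open SimpleGraph Finset

variable {V : Type u} {G : SimpleGraph V} {D : ℕ} {p : ℕ → V} {i h : V → ℕ}

theorem IsGate.height_path (hg : IsGate G D p i h) {x : ℕ} (hx : x ≤ D) :
    h (p x) = 0 ∧ i (p x) = x := by
  have := hg.dist_path (p x) x hx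
  rw [G.dist_self] at this
  omega

/-- By `IsGate.height_le`, no branch reaches farther than the path end beyond it, so the farther end
realises the eccentricity. -/
theorem IsGate.ecc_eq [Finite V] (hg : IsGate G D p i h) (hG : G.Connected)
    (hD : ∀ u v, G.dist u v ≤ D) (w : V) : ecc G w = h w + (D - min (i w) (D - i w)) := by
  have h0 := hg.le w
  refine hG.eccent_eq (fun u => ?_) ?_
  · have h1 := hg.height_le hD w
    have h2 := hg.height_le hD u
    have h3 := hg.le u
    by_cases e : i w = i u
    · obtain ⟨c, -, -, hc⟩ := hg.dist_of_eq w u e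
      omega
    · rw [hg.dist_of_ne w u e]
      omega
  · rcases le_total (i w) (D - i w) with hle | hle
    · exact ⟨p D, by rw [hg.dist_path w D le_rfl]; omega⟩
    · exact ⟨p 0, by rw [hg.dist_path w 0 (by omega)]; omega⟩

/-- The vertices of a tree are those of a given geodesic and those off it. -/
noncomputable def IsGate.vertexEquiv (hg : IsGate G D p i h) (hG : G.Connected) :
    Fin (D + 1) ⊕ {w : V // 0 < h w} ≃ V :=
  Equiv.ofBijective (Sum.elim (fun x => p x.val) Subtype.val) <| by
    have hp := fun x : Fin (D + 1) => hg.height_path (Nat.lt_succ_iff.1 x.2)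
    constructor
    · rintro (x | u) (y | v) hxy <;> simp only [Sum.elim_inl, Sum.elim_inr] at hxy
      · exact congrArg _ (Fin.ext (by rw [← (hp x).2, hxy, (hp y).2]))
      · have := v.2
        rw [← hxy, (hp x).1] at this
        omega
      · have := u.2
        rw [hxy, (hp y).1] at this
        omega
      · exact congrArg _ (Subtype.ext hxy)
    · intro v
      by_cases hv : 0 < h v
      · exact ⟨.inr ⟨v, hv⟩, rfl⟩
      · have hle := hg.le v
        refine ⟨.inl ⟨i v, by omega⟩, ?_⟩
        have : G.dist v (p (i v)) = 0 := by
          have := hg.dist_path v (i v) hle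
          omega
        exact (hG.dist_eq_zero_iff.1 this).symm

@[simp] theorem IsGate.vertexEquiv_inl (hg : IsGate G D p i h) (hG : G.Connected)
    (x : Fin (D + 1)) : hg.vertexEquiv hG (.inl x) = p x := rfl

@[simp] theorem IsGate.vertexEquiv_inr (hg : IsGate G D p i h) (hG : G.Connected)
    (w : {w : V // 0 < h w}) : hg.vertexEquiv hG (.inr w) = w := rfl

theorem card_filter_path_ecc {b : ℕ} (hb : D < 2 * b) (hbD : b ≤ D) :
    ((univ : Finset (Fin (D + 1))).filter fun x => D - min x.val (D - x.val) = b).card = 2 := by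
  rw [card_eq_two]
  refine ⟨⟨b, by omega⟩, ⟨D - b, by omega⟩, by simp only [ne_eq, Fin.mk.injEq]; omega, ?_⟩
  ext x
  simp only [mem_filter, mem_univ, true_and, mem_insert, mem_singleton, Fin.ext_iff]
  omega

/-- Exactly two path vertices have a given eccentricity above the least one, namely `p b` and `p (D
- b)`. This is the 2 subtracted from each multiplicity. -/
theorem IsGate.card_filter_ecc [Fintype V] (hg : IsGate G D p i h) (hG : G.Connected)
    (hD : ∀ u v, G.dist u v ≤ D) {b : ℕ} (hb : D < 2 * b) (hbD : b ≤ D) :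
    (univ.filter fun v => ecc G v = b).card =
      2 + (univ.filter fun w : {w : V // 0 < h w} => ecc G w = b).card := by
  rw [← card_filter_path_ecc hb hbD, card_filter, card_filter, card_filter,
    ← (hg.vertexEquiv hG).sum_comp, Fintype.sum_sum_type]
  congr 1
  refine sum_congr rfl fun x _ => ?_
  obtain ⟨h1, h2⟩ := hg.height_path (Nat.lt_succ_iff.1 x.2)
  rw [hg.vertexEquiv_inl, hg.ecc_eq hG hD, h1, h2, zero_add]

/-- The path already takes every value from `⌈D/2⌉` to `D`, and no vertex takes another. -/
theorem IsGate.eccentricSequence_data [Fintype V] (hg : IsGate G D p i h) (hG : G.Connected)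
    (hD : ∀ u v, G.dist u v ≤ D) :
    leastValue (eccentricSequence G) = (D + 1) / 2 ∧
      laterMultiplicities (eccentricSequence G) =
        (List.range' ((D + 1) / 2 + 1) (D - (D + 1) / 2)).map
          fun b => (univ.filter fun v => ecc G v = b).card := by
  have hval : distinctValues (eccentricSequence G) =
      List.range' ((D + 1) / 2) (D - (D + 1) / 2 + 1) := by
    refine distinctValues_eq fun b => ?_
    rw [mem_eccentricSequence]
    constructor
    · rintro ⟨v, rfl⟩
      have := hg.height_le hD v
      have := hg.le v
      rw [hg.ecc_eq hG hD]
      omega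
    · intro hb
      obtain ⟨h1, h2⟩ := hg.height_path (x := b) (by omega)
      exact ⟨p b, by rw [hg.ecc_eq hG hD, h1, h2]; omega⟩
  rw [leastValue, laterMultiplicities, hval, List.range'_succ]
  simp [count_eccentricSequence]

variable {r : ℕ} {m : List ℕ}

theorem IsGate.exists_equiv_pendent [Fintype V] (hg : IsGate G (r + m.length) p i h)
    (hG : G.Connected) (hD : ∀ u v, G.dist u v ≤ r + m.length) (hr : r ≤ m.length + 1)
    (hr' : m.length ≤ r)
    (hm : ∀ j : Fin m.length, m.get j = (univ.filter fun v => ecc G v = r + 1 + j.val).card) :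
    ∃ e : {w : V // 0 < h w} ≃ Σ j : Fin m.length, Fin (m.get j - 2),
      ∀ w, catFoot (e w) = foot (r + m.length) i h w := by
  have hfoot : ∀ w : {w : V // 0 < h w}, 1 ≤ foot (r + m.length) i h w ∧
      foot (r + m.length) i h w ≤ m.length ∧
      ecc G w + foot (r + m.length) i h w = r + m.length + 1 := by
    intro w
    have h1 := hg.height_le hD w
    have h2 := hg.le w
    have h3 := w.2
    rw [hg.ecc_eq hG hD, foot]
    omega
  -- Eccentricity and foot add up to `D + 1`, so the class of eccentricity `r + 1 + j` is the one
  -- with foot `m.length - j`.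
  obtain ⟨e, he⟩ := exists_equiv_sigma_fin
    (fun w : {w : V // 0 < h w} => (⟨m.length - foot (r + m.length) i h w, by
      have := hfoot w; omega⟩ : Fin m.length)) (fun j => m.get j - 2) (by
      intro j
      rw [hm j, hg.card_filter_ecc hG hD (by omega) (by omega), add_tsub_cancel_left]
      refine congrArg card (Finset.ext fun w => ?_)
      have := hfoot w
      simp only [mem_filter, mem_univ, true_and, Fin.ext_iff]
      omega)
  refine ⟨e, fun w => ?_⟩
  have := hfoot w
  rw [catFoot, he]
  simp only
  omega

/-- The bijection between the vertices of a tree and those of its caterpillar. -/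
noncomputable def IsGate.catEquiv (hg : IsGate G (r + m.length) p i h) (hG : G.Connected)
    (e : {w : V // 0 < h w} ≃ Σ j : Fin m.length, Fin (m.get j - 2)) : V ≃ CatVertex r m :=
  (hg.vertexEquiv hG).symm.trans (Equiv.sumCongr (Equiv.refl _) e)

theorem IsGate.catEquiv_path (hg : IsGate G (r + m.length) p i h) (hG : G.Connected)
    (e : {w : V // 0 < h w} ≃ Σ j : Fin m.length, Fin (m.get j - 2))
    (x : Fin (r + m.length + 1)) :
    hg.catEquiv hG e (p x) = .inl x := by
  rw [← hg.vertexEquiv_inl hG, IsGate.catEquiv, Equiv.trans_apply, Equiv.symm_apply_apply]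
  rfl

theorem IsGate.catEquiv_pendent (hg : IsGate G (r + m.length) p i h) (hG : G.Connected)
    (e : {w : V // 0 < h w} ≃ Σ j : Fin m.length, Fin (m.get j - 2))
    (w : {w : V // 0 < h w}) :
    hg.catEquiv hG e w = .inr (e w) := by
  rw [← hg.vertexEquiv_inr hG, IsGate.catEquiv, Equiv.trans_apply, Equiv.symm_apply_apply]
  rfl

theorem IsGate.forall_vertex (hg : IsGate G (r + m.length) p i h) (hG : G.Connected)
    (P : V → Prop) (h1 : ∀ x : Fin (r + m.length + 1), P (p x))
    (h2 : ∀ w : {w : V // 0 < h w}, P w) (v : V) : P v := by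
  obtain ⟨x | w, rfl⟩ := (hg.vertexEquiv hG).surjective v
  · exact h1 x
  · exact h2 w

theorem IsGate.ecc_catEquiv [Finite V] (hg : IsGate G (r + m.length) p i h) (hG : G.Connected)
    (e : {w : V // 0 < h w} ≃ Σ j : Fin m.length, Fin (m.get j - 2))
    (hD : ∀ u v, G.dist u v ≤ r + m.length)
    (hr' : m.length ≤ r) (he : ∀ w, catFoot (e w) = foot (r + m.length) i h w) (v : V) :
    ecc (catTree r m) (hg.catEquiv hG e v) = ecc G v := by
  revert v
  refine hg.forall_vertex hG _ (fun x => ?_) (fun w => ?_)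
  · obtain ⟨h1, h2⟩ := hg.height_path (Nat.lt_succ_iff.1 x.2)
    rw [hg.catEquiv_path, ecc_catTree_inl hr', hg.ecc_eq hG hD, h1, h2]
    omega
  · have := hg.height_le hD w
    have := hg.le w
    rw [hg.catEquiv_pendent, ecc_catTree_inr hr', hg.ecc_eq hG hD, he, foot]
    omega

theorem catTree_dist_pendent
    (e : {w : V // 0 < h w} ≃ Σ j : Fin m.length, Fin (m.get j - 2))
    (he : ∀ w, catFoot (e w) = foot (r + m.length) i h w)
    (u w : {w : V // 0 < h w}) :
    (catTree r m).dist (.inr (e u)) (.inr (e w)) = pendentDist (r + m.length) i h u w := by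
  rw [catTree_dist, catDist, pendentDist, he, he]
  by_cases huw : u = w
  · subst huw
    rw [if_pos rfl, if_pos rfl]
  · rw [if_neg (e.injective.ne huw), if_neg (Subtype.coe_ne_coe.2 huw)]

/-- Path–path terms cancel, and the mixed terms occur in both orders. -/
theorem IsGate.sum_sub_sum_eq_totalGain [Fintype V] (hg : IsGate G (r + m.length) p i h)
    (hG : G.Connected)
    (e : {w : V // 0 < h w} ≃ Σ j : Fin m.length, Fin (m.get j - 2))
    (hp : IsGeodesicSeq G (r + m.length) p)
    (he : ∀ w, catFoot (e w) = foot (r + m.length) i h w) (g : ℕ → ℝ) :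
    ∑ u, ∑ v, g (G.dist u v) - ∑ a, ∑ b, g ((catTree r m).dist a b) =
      totalGain G (r + m.length) p i h g := by
  rw [← (hg.vertexEquiv hG).sum_comp,
    ← (Equiv.sumCongr (Equiv.refl (Fin (r + m.length + 1))) e).sum_comp]
  simp_rw [← (hg.vertexEquiv hG).sum_comp (fun v => g (G.dist _ v)),
    ← (Equiv.sumCongr (Equiv.refl (Fin (r + m.length + 1))) e).sum_comp
      (fun b => g ((catTree r m).dist _ b)), Fintype.sum_sum_type]
  simp only [vertexEquiv_inl, vertexEquiv_inr, Equiv.sumCongr_apply, Sum.map_inl, Sum.map_inr,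
    Equiv.refl_apply, catTree_dist_pendent e he, sum_add_distrib]
  have e1 : ∀ x y : Fin (r + m.length + 1),
      (catTree r m).dist (.inl x) (.inl y) = G.dist (p x) (p y) := fun x y => by
    rw [catTree_dist, hp _ _ (by omega) (by omega)]; rfl
  have e2 : ∀ (x : Fin (r + m.length + 1)) (w : {w : V // 0 < h w}),
      (catTree r m).dist (.inl x) (.inr (e w)) = 1 + ((x.val - foot (r + m.length) i h w) +
        (foot (r + m.length) i h w - x.val)) := fun x w => by
    rw [catTree_dist, ← he]; rfl
  have e3 : ∀ (x : Fin (r + m.length + 1)) (w : {w : V // 0 < h w}),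
      (catTree r m).dist (.inr (e w)) (.inl x) = 1 + ((x.val - foot (r + m.length) i h w) +
        (foot (r + m.length) i h w - x.val)) := fun x w => by
    rw [dist_comm, e2]
  simp only [e1, e2, e3]
  rw [sum_comm (f := fun (x : Fin (r + m.length + 1)) (w : {w : V // 0 < h w}) =>
    g (G.dist (p x) w)), sum_comm (f := fun (x : Fin (r + m.length + 1)) (w : {w : V // 0 < h w}) =>
    g (1 + ((x.val - foot (r + m.length) i h w) + (foot (r + m.length) i h w - x.val))))]
  have e4 : ∀ (x : Fin (r + m.length + 1)) (w : {w : V // 0 < h w}),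
      G.dist (p x) w = G.dist w (p x) := fun x w => dist_comm
  simp only [e4, totalGain, pathGain, sum_sub_distrib]
  ring

/-- At height 1 with the gate in the near half, the foot is the gate itself, so the vertex bijection
is an isometry. -/
theorem IsGate.nonempty_iso_catTree (hg : IsGate G (r + m.length) p i h) (hG : G.Connected)
    (e : {w : V // 0 < h w} ≃ Σ j : Fin m.length, Fin (m.get j - 2))
    (hp : IsGeodesicSeq G (r + m.length) p)
    (he : ∀ w, catFoot (e w) = foot (r + m.length) i h w) (hh : ∀ w, h w ≤ 1)
    (hd : ∀ u w, 0 < h u → 0 < h w → G.dist u w = pendentDist (r + m.length) i h u w)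
    (hi : ∀ w, 0 < h w → i w ≤ r + m.length - i w) : Nonempty (G ≃g catTree r m) := by
  have key : ∀ u v, (catTree r m).dist (hg.catEquiv hG e u) (hg.catEquiv hG e v) = G.dist u v := by
    have mixed : ∀ (x : Fin (r + m.length + 1)) (w : {w : V // 0 < h w}),
        (catTree r m).dist (.inl x) (.inr (e w)) = G.dist w (p x) := fun x w => by
      have h1 := hi w w.2
      have h2 := hh w
      have h3 := w.2
      rw [catTree_dist, catDist, he, foot, hg.dist_path w x (by omega)]
      omega
    refine hg.forall_vertex hG _ (fun x => ?_) (fun u => ?_)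
    · refine hg.forall_vertex hG _ (fun y => ?_) (fun w => ?_)
      · rw [hg.catEquiv_path, hg.catEquiv_path, catTree_dist, hp _ _ (by omega) (by omega)]
        rfl
      · rw [hg.catEquiv_path, hg.catEquiv_pendent, mixed, dist_comm]
    · refine hg.forall_vertex hG _ (fun y => ?_) (fun w => ?_)
      · rw [hg.catEquiv_path, hg.catEquiv_pendent, dist_comm, mixed]
      · rw [hg.catEquiv_pendent, hg.catEquiv_pendent, catTree_dist_pendent e he, hd u w u.2 w.2]
  exact ⟨⟨hg.catEquiv hG e, fun {u v} => by rw [← dist_eq_one_iff_adj, key, dist_eq_one_iff_adj]⟩⟩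

/-- If the pendent vertices off a geodesic have the mutual distances of those of the caterpillar,
then they all hang at the same half of the geodesic. -/
theorem IsGate.same_side (hg : IsGate G D p i h) (hh : ∀ w, h w ≤ 1)
    (hd : ∀ u w, 0 < h u → 0 < h w → G.dist u w = pendentDist D i h u w) :
    (∀ w, 0 < h w → i w ≤ D - i w) ∨ ∀ w, 0 < h w → D - i w ≤ i w := by
  by_contra! hcon
  obtain ⟨⟨u, hu, hu'⟩, w, hw, hw'⟩ := hcon
  have huw : u ≠ w := by rintro rfl; omega
  have h1 := hd u w hu hw
  have h2 := hh u
  have h3 := hh w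
  have h4 := hg.le u
  have h5 := hg.le w
  -- With gates strictly on opposite sides of the centre, folding the path brings the feet strictly
  -- closer together than the gates.
  rw [pendentDist, if_neg huw, hg.dist_of_ne u w (by rintro h; rw [h] at hu'; omega), foot, foot] at h1
  omega

end Bijection

/-! ### Minimality, uniqueness and the four indices. -/

section Minimality

open SimpleGraph Finset

variable {V : Type u} {G : SimpleGraph V}

/-- The entries of the eccentric sequence of a tree with a diametral path, in the notation
`(r; m₂, …, m_l)`. -/
theorem SimpleGraph.IsTree.exists_diametral_path [Fintype V] (hG : G.IsTree) :
    ∃ (r : ℕ) (m : List ℕ) (p : ℕ → V) (i h : V → ℕ),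
      leastValue (eccentricSequence G) = r ∧ laterMultiplicities (eccentricSequence G) = m ∧
      IsGeodesicSeq G (r + m.length) p ∧ IsGate G (r + m.length) p i h ∧
      (∀ u v, G.dist u v ≤ r + m.length) ∧ r ≤ m.length + 1 ∧ m.length ≤ r ∧
      ∀ j : Fin m.length, m.get j = (univ.filter fun v => ecc G v = r + 1 + j.val).card := by
  have := hG.1.nonempty
  obtain ⟨a, b, hab⟩ := G.exists_dist_eq_diam
  obtain ⟨p, hp, -, -⟩ := hG.1.exists_isGeodesicSeq a b
  rw [hab] at hp
  obtain ⟨i, h, hg⟩ := hp.exists_isGate hG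
  have hD : ∀ u v, G.dist u v ≤ G.diam := fun u v =>
    dist_le_diam (connected_iff_ediam_ne_top.1 hG.1)
  obtain ⟨h1, h2⟩ := hg.eccentricSequence_data hG.1 hD
  have hlen := congrArg List.length h2
  rw [List.length_map, List.length_range'] at hlen
  have hsum : leastValue (eccentricSequence G) + (laterMultiplicities (eccentricSequence G)).length =
      G.diam := by omega
  refine ⟨_, _, p, i, h, rfl, rfl, hsum ▸ hp, hsum ▸ hg, hsum ▸ hD, by omega, by omega, fun j => ?_⟩
  rw [List.get_eq_getElem]
  simp only [h2, List.getElem_map, List.getElem_range', one_mul, h1]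

/-- Only values up to the diameter matter, and `1 / (D + 1 - x)` stops increasing beyond `D`; the
comparison uses a globally increasing function. -/
theorem StrictMonoOn.exists_strictMono {g : ℕ → ℝ} {D : ℕ} (hg : StrictMonoOn g (Set.Iic D)) :
    ∃ f : ℕ → ℝ, StrictMono f ∧ ∀ x ≤ D, f x = g x := by
  refine ⟨fun x => g (min x D) + ((x - D : ℕ) : ℝ), strictMono_nat_of_lt_succ fun x => ?_,
    fun x hx => by simp [hx]⟩
  rcases Nat.lt_or_ge x D with hx | hx
  · have e1 : x - D = 0 := by omega
    have e2 : x + 1 - D = 0 := by omega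
    rw [min_eq_left hx.le, min_eq_left (Nat.succ_le_of_lt hx), e1, e2, add_lt_add_iff_right]
    exact hg (Set.mem_Iic.2 hx.le) (Set.mem_Iic.2 hx) (Nat.lt_succ_self x)
  · rw [min_eq_right hx, min_eq_right (hx.trans (Nat.le_succ x)), Nat.succ_sub hx]
    push_cast
    linarith

/-- The caterpillar of the eccentric sequence of a tree has the same eccentric sequence and the
same diameter, and is the unique minimiser of every strictly increasing index of Wiener type. -/
theorem SimpleGraph.IsTree.catTree_minimal [Fintype V] [DecidableEq V] (hG : G.IsTree)
    {r : ℕ} {m : List ℕ} (hr : leastValue (eccentricSequence G) = r)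
    (hm : laterMultiplicities (eccentricSequence G) = m) :
    eccentricSequence (catTree r m) = eccentricSequence G ∧
    (catTree r m).diam = G.diam ∧
    ∀ g : ℕ → ℝ, StrictMonoOn g (Set.Iic G.diam) →
      wienerType (catTree r m) g ≤ wienerType G g ∧
      (wienerType G g = wienerType (catTree r m) g ↔ Nonempty (G ≃g catTree r m)) := by
  obtain ⟨r', m', p, i, h, hr', hm', hp, hg, hD, hr1, hr2, hcard⟩ := hG.exists_diametral_path
  obtain rfl : r' = r := hr'.symm.trans hr
  obtain rfl : m' = m := hm'.symm.trans hm
  clear hr hm hr' hm'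
  have hdiam : G.diam = r' + m'.length := hG.1.diam_eq hD
    ⟨p 0, p (r' + m'.length), by rw [hp _ _ (by omega) le_rfl]; omega⟩
  obtain ⟨e, he⟩ := hg.exists_equiv_pendent hG.1 hD hr1 hr2 hcard
  refine ⟨eccentricSequence_congr (hg.catEquiv hG.1 e) (hg.ecc_catEquiv hG.1 e hD hr2 he),
    by rw [hdiam, catTree_diam hr2], fun g hmono => ?_⟩
  rw [hdiam] at hmono
  obtain ⟨f, hf, hfg⟩ := hmono.exists_strictMono
  rw [← wienerType_congr hD hfg, ← wienerType_congr (catTree_dist_le hr2) hfg]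
  have w1 := two_mul_wienerType_add G f
  have w2 := two_mul_wienerType_add (catTree r' m') f
  rw [← Fintype.card_congr (hg.catEquiv hG.1 e)] at w2
  have gain := hg.sum_sub_sum_eq_totalGain hG.1 e hp he f
  have nonneg := hg.totalGain_nonneg hG hD hf
  refine ⟨by linarith, fun heq => ?_, fun ⟨φ⟩ => ?_⟩
  · obtain ⟨hh, hd⟩ := hg.of_totalGain_eq_zero hG hD hf (by linarith)
    rcases hg.same_side hh hd with hs | hs
    · exact hg.nonempty_iso_catTree hG.1 e hp he hh hd hs
    -- All gates are in the far half. Reversing the path gives the same difference of sums, again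
    -- zero, with gates in the near half.
    · have hg' := hg.reverse
      obtain ⟨e', he'⟩ := hg'.exists_equiv_pendent hG.1 hD hr1 hr2 hcard
      have gain' := hg'.sum_sub_sum_eq_totalGain hG.1 e' hp.reverse he' f
      obtain ⟨-, hd'⟩ := hg'.of_totalGain_eq_zero hG hD hf (by linarith)
      refine hg'.nonempty_iso_catTree hG.1 e' hp.reverse he' hh hd' fun w hw => ?_
      have := hs w hw
      have := hg.le w
      omega
  · have : ∑ u, ∑ v, f (G.dist u v) = ∑ a, ∑ b, f ((catTree r' m').dist a b) := by
      rw [← φ.toEquiv.sum_comp]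
      refine sum_congr rfl fun u _ => ?_
      rw [← φ.toEquiv.sum_comp]
      exact sum_congr rfl fun v _ => by rw [← φ.dist_eq hG.1 u v]; rfl
    linarith

theorem strictMono_choose_two : StrictMono fun x : ℕ => ((Nat.choose (1 + x) 2 : ℕ) : ℝ) := by
  refine strictMono_nat_of_lt_succ fun x => ?_
  rcases Nat.eq_zero_or_pos x with rfl | hx
  · norm_num
  · rw [← add_assoc, Nat.cast_lt, Nat.choose_succ_succ' (1 + x) 1, Nat.choose_one_right]
    exact Nat.lt_add_of_pos_left (by omega)

theorem strictMonoOn_reciprocal_complementary (D : ℕ) :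
    StrictMonoOn (fun x : ℕ => 1 / ((D : ℝ) + 1 - (x : ℝ))) (Set.Iic D) := by
  intro x _ y hy hxy
  have h1 : (y : ℝ) ≤ D := Nat.cast_le.2 hy
  have h2 : (x : ℝ) < y := Nat.cast_lt.2 hxy
  exact one_div_lt_one_div_of_lt (by linarith) (by linarith)

end Minimality

theorem corollary1 (S : List ℕ) (hS : IsTreeEccentricSequence S) :
    -- the competitor is itself a tree with eccentric sequence `S`
    ((catTree (leastValue S) (laterMultiplicities S)).IsTree ∧
      eccentricSequence (catTree (leastValue S) (laterMultiplicities S)) = S) ∧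
    -- and it is, up to isomorphism, the only minimiser of each index among all such trees
    ∀ (V : Type u) [Fintype V] [DecidableEq V] (T : SimpleGraph V),
      T.IsTree → eccentricSequence T = S →
      (wienerIndex (catTree (leastValue S) (laterMultiplicities S)) ≤ wienerIndex T ∧
        (wienerIndex T = wienerIndex (catTree (leastValue S) (laterMultiplicities S)) ↔
          Nonempty (T ≃g catTree (leastValue S) (laterMultiplicities S)))) ∧
      (hyperWienerIndex (catTree (leastValue S) (laterMultiplicities S)) ≤ hyperWienerIndex T ∧
        (hyperWienerIndex T = hyperWienerIndex (catTree (leastValue S) (laterMultiplicities S)) ↔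
          Nonempty (T ≃g catTree (leastValue S) (laterMultiplicities S)))) ∧
      (∀ a : ℝ, 0 < a →
        generalisedWienerIndex (catTree (leastValue S) (laterMultiplicities S)) a ≤
          generalisedWienerIndex T a ∧
        (generalisedWienerIndex T a =
            generalisedWienerIndex (catTree (leastValue S) (laterMultiplicities S)) a ↔
          Nonempty (T ≃g catTree (leastValue S) (laterMultiplicities S)))) ∧
      (reciprocalComplementaryWienerIndex (catTree (leastValue S) (laterMultiplicities S)) ≤
          reciprocalComplementaryWienerIndex T ∧
        (reciprocalComplementaryWienerIndex T =
            reciprocalComplementaryWienerIndex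
              (catTree (leastValue S) (laterMultiplicities S)) ↔
          Nonempty (T ≃g catTree (leastValue S) (laterMultiplicities S)))) := by
  refine ⟨⟨catTree_isTree, ?_⟩, ?_⟩
  · obtain ⟨n, T, -, hT, rfl⟩ := hS
    exact (hT.catTree_minimal rfl rfl).1
  · rintro V _ _ T hT rfl
    obtain ⟨-, hdiam, hmin⟩ := hT.catTree_minimal rfl rfl
    refine ⟨hmin _ fun x _ y _ hxy => Nat.cast_lt.2 hxy, hmin _ (strictMono_choose_two.strictMonoOn _),
      fun a ha => hmin _ fun x _ y _ hxy =>
        Real.rpow_lt_rpow (Nat.cast_nonneg x) (Nat.cast_lt.2 hxy) ha, ?_⟩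
    -- Equal diameters make this index use the same function of distance for both trees.
    simp only [reciprocalComplementaryWienerIndex, hdiam]
    exact hmin _ (strictMonoOn_reciprocal_complementary _)
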